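/- Conventions. For $f\in\mathbb Z_4[x]$ let $\bar f\in\mathbb Z_2[x]$ be its reduction and $f^*(x)=x^{\deg f}f(1/x)$. A polynomial $h\in\mathbb Z_4[x]$ is basic irreducible if it is monic and $\bar h$ is irreducible. If $f=\prod_{h\in S}h$ and $g=\prod_{h\in T}h$ for finite sets $S,T$ such that the members of $S\cup T$ are basic irreducible and pairwise coprime, put $\gcd_4(f,g)=\prod_{h\in S\cap T}h$. Let $m_1,\dots,m_l$ be odd positive integers, $R_j=\mathbb Z_4[x]/\langle x^{m_j}-1\rangle$ and $R=R_1\times\cdots\times R_l$. A generalized quasi-cyclic (GQC) code of block lengths $(m_1,\dots,m_l)$ is a $\mathbb Z_4[x]$-submodule $\mathcal C$ of $R$, identified with a code in $\mathbb Z_4^{m_1}\times\cdots\times\mathbb Z_4^{m_l}$ through coefficients; $\mathcal C^\perp$ is its dual for the Euclidean inner product. A normalized generating set of $\mathcal C$ is a generating set $\mathbf a_r=(F_{r,1}|\cdots|F_{r,r}|0|\cdots|0)$, $1\le r\le l$, with $F_{r,j}\in\mathbb Z_4[x]$ and $F_{r,r}=f_r+2g_r$, where $f_r$ is monic, $f_r\mid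 x^{m_r}-1$, and either $g_r$ is monic with $g_r\mid f_r$, or $g_r=0$. Elimination. Let $1\le i\le l$, let ${}_{(i)}\mathcal C$ be the projection of $\mathcal C$ to $R_1\times\cdots\times R_i$, and let $\mathbf g_r=(G_{r,1}|\cdots|G_{r,r}|0|\cdots|0)$, $1\le r\le i$, be a normalized generating set of ${}_{(i)}\mathcal C$ such that every $G_{r,r}$ is monic and $\overline{G_{r,r}}$ has no multiple roots. Elimination in row $r$ is the following process: $\mathbf g_r^{(0)}=\mathbf g_r$, and for $k=0,\dots,r-2$, with $j=r-k-1$ and $d=\gcd_4(G_{j,j},G_{r,j}^{(k)})$, $$A_{r,j}^{(k+1)}=\frac{G_{j,j}}{d},\qquad B_{r,j}^{(k+1)}=\frac{G_{r,j}^{(k)}}{d},\qquad \mathbf g_r^{(k+1)}=A_{r,j}^{(k+1)}\mathbf g_r^{(k)}-B_{r,j}^{(k+1)}\mathbf g_j ,$$ where $G_{r,1}^{(k)},\dots,G_{r,r}^{(k)}$ denote polynomials representing the components of $\mathbf g_r^{(k)}$, with $G_{r,r}^{(k+1)}=A_{r,j}^{(k+1)}G_{r,r}^{(k)}$. We say that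 row $r$ admits elimination if, for $k=0,\dots,r-2$, $G_{r,r-k-1}^{(k)}$ is monic, its reduction has no multiple roots, and the above $\gcd_4$ is defined (a pairwise coprime family as above exists). Proposition 5. Let $\mathcal C$ be a GQC code with normalized generating set $\{\mathbf a_1,\dots,\mathbf a_l\}$ such that $F_{j,j}\mid x^{m_j}-1$ for $j=1,\dots,l$, and let $\mathbf e_r=(E_{r,1}|\cdots|E_{r,r}|0|\cdots|0)$, $1\le r\le l$, be a normalized generating set of $\mathcal C^\perp$. Let $1\le i\le l$, and suppose that the rows $r=1,\dots,i-1$ of ${}_{(i)}\mathcal C$ admit elimination. Then there are $\lambda_{i,r}\in\mathbb Z_4[x]$, $1\le r\le i$, such that $$E_{i,r}\,\bigl(G_{r,r}^{(r-1)}\bigr)^*=(x^{m_r}-1)\lambda_{i,r}\qquad(1\le r\le i-1),$$ and, with $m'=\mathrm{lcm}(m_1,\dots,m_i)$, for $s=2,\dots,i-1$ $$\lambda_{i,s}\equiv 3\lambda_{i,1}\bigl(B_{s,1}^{(s-1)}\bigr)^*x^{m'+\deg G_{s,s}^{(s-2)}-\deg G_{s,1}^{(s-2)}}\pmod{\bigl(A_{s,1}^{(s-1)}\bigr)^*}.$$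 If moreover row $i$ admits elimination, then $E_{i,i}\bigl(G_{i,i}^{(i-1)}\bigr)^*=(x^{m_i}-1)\lambda_{i,i}$, and if $i\ge2$, then $\bigl(B_{i,1}^{(i-1)}\bigr)^*$ is invertible modulo $\bigl(A_{i,1}^{(i-1)}\bigr)^*$ and $$\lambda_{i,1}\equiv 3\lambda_{i,i}\Bigl(\bigl(B_{i,1}^{(i-1)}\bigr)^*\Bigr)^{-1}x^{m'+\deg G_{i,1}^{(i-2)}-\deg G_{i,i}^{(i-2)}}\pmod{\bigl(A_{i,1}^{(i-1)}\bigr)^*}.$$ In these congruences $x$ is invertible modulo the modulus, so the powers of $x$ make sense for every integer exponent. -/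

import Mathlib

open Polynomial

namespace GQC

/-- The polynomial ring `ℤ₄[x]`. -/
abbrev P4 := (ZMod 4)[X]

/-- Reduction of coefficients modulo two, `ℤ₄[x] → ℤ₂[x]`. -/
noncomputable def red (f : P4) : (ZMod 2)[X] :=
  f.map (ZMod.castHom (by norm_num : 2 ∣ 4) (ZMod 2))

/-- The reduction of `f` modulo two has no multiple roots (in any extension field), i.e. it is
coprime to its derivative. -/
def NoMultRoots (f : P4) : Prop := (red f).Separable

/-- Basic irreducible polynomials over `ℤ₄`. -/
def BasicIrreducible (f : P4) : Prop := f.Monic ∧ Irreducible (red f)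

open Classical in
/-- `d = gcd₄(f, g)`: `f` and `g` are products, with exponents `0` or `1`, of members of one family
`S ∪ T` of pairwise coprime basic irreducible polynomials, and `d` is the product of
the members that occur in both. -/
def IsGcd4 (f g d : P4) : Prop :=
  ∃ S T : Finset P4,
    (∀ h ∈ S ∪ T, BasicIrreducible h) ∧
    (∀ h ∈ S ∪ T, ∀ h' ∈ S ∪ T, h ≠ h' → IsCoprime h h') ∧
    f = ∏ h ∈ S, h ∧ g = ∏ h ∈ T, h ∧ d = ∏ h ∈ S ∩ T, h

/-- The ring `ℤ₄[x]/⟨x^n - 1⟩`. -/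
abbrev Blk (n : ℕ) := P4 ⧸ Ideal.span {(X ^ n - 1 : P4)}

/-- The residue class of a polynomial in `ℤ₄[x]/⟨x^n - 1⟩`. -/
noncomputable abbrev toBlk (n : ℕ) (f : P4) : Blk n := Ideal.Quotient.mk _ f

/-- The module `R = R₁ × ⋯ × R_l`, with `R_j = ℤ₄[x]/⟨x^{m_j} - 1⟩`. Generalized quasi-cyclic codes of
block lengths `(m₁, …, m_l)` are the `ℤ₄[x]`-submodules of `R`. -/
abbrev Amb (m : ℕ → ℕ) (l : ℕ) := ∀ j : Finset.Icc 1 l, Blk (m j)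

/-- The words `(c_{1,0}, …, c_{1,m₁-1} | ⋯ | c_{l,0}, …, c_{l,m_l-1})` over `ℤ₄`. -/
abbrev Word (m : ℕ → ℕ) (l : ℕ) := ∀ j : Finset.Icc 1 l, Fin (m j) → ZMod 4

/-- The identification of words with elements of `R`. -/
noncomputable def ofWord {m : ℕ → ℕ} {l : ℕ} (w : Word m l) : Amb m l :=
  fun j => toBlk (m j) (∑ k : Fin (m j), C (w j k) * X ^ (k : ℕ))

/-- The Euclidean inner product of words. -/
def dot {m : ℕ → ℕ} {l : ℕ} (v w : Word m l) : ZMod 4 := ∑ j, ∑ k, v j k * w j k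

/-- The simultaneous cyclic shift of all blocks. -/
def shift {m : ℕ → ℕ} {l : ℕ} (w : Word m l) : Word m l :=
  fun j k => w j ((finRotate (m j)).symm k)

theorem dot_shift {m : ℕ → ℕ} {l : ℕ} (v w : Word m l) : dot (shift v) (shift w) = dot v w := by
  unfold dot shift
  refine Finset.sum_congr rfl fun j _ => ?_
  exact Equiv.sum_comp (finRotate (m j)).symm (fun k => v j k * w j k)

theorem shift_injective {m : ℕ → ℕ} {l : ℕ} : Function.Injective (shift (m := m) (l := l)) := by
  intro v w h
  funext j k
  have := congrFun (congrFun h j) (finRotate (m j) k)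
  simpa only [shift, Equiv.symm_apply_apply] using this

theorem toBlk_pow_rotate (n : ℕ) (k : Fin n) :
    toBlk n (X ^ ((finRotate n k : Fin n) : ℕ)) = toBlk n (X ^ ((k : ℕ) + 1)) := by
  cases n with
  | zero => exact k.elim0
  | succ n =>
    rw [coe_finRotate]
    split_ifs with h
    · subst h
      refine (Ideal.Quotient.eq).2 (Ideal.mem_span_singleton.2 ⟨-1, ?_⟩)
      simp
    · rfl

theorem ofWord_shift {m : ℕ → ℕ} {l : ℕ} (w : Word m l) :
    ofWord (shift w) = (X : P4) • ofWord w := by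
  funext j
  have h1 : (∑ k : Fin (m j), C (shift w j k) * X ^ (k : ℕ) : P4)
      = ∑ k : Fin (m j), C (w j k) * X ^ ((finRotate (m j) k : Fin (m j)) : ℕ) := by
    rw [← Equiv.sum_comp (finRotate (m j))]
    simp only [shift, Equiv.symm_apply_apply]
  have h2 : ((X : P4) • ofWord w) j
      = toBlk (m j) (X * ∑ k : Fin (m j), C (w j k) * X ^ (k : ℕ)) := rfl
  rw [h2]
  change toBlk (m j) (∑ k : Fin (m j), C (shift w j k) * X ^ (k : ℕ)) = _
  rw [h1, Finset.mul_sum]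
  unfold toBlk
  rw [map_sum, map_sum]
  refine Finset.sum_congr rfl fun k _ => ?_
  have h3 := toBlk_pow_rotate (m j) k
  have h4 : (X * (C (w j k) * X ^ (k : ℕ)) : P4) = C (w j k) * X ^ ((k : ℕ) + 1) := by ring
  rw [h4, map_mul, map_mul]
  exact congrArg _ h3

theorem ofWord_add {m : ℕ → ℕ} {l : ℕ} (v w : Word m l) :
    ofWord (v + w) = ofWord v + ofWord w := by
  funext j
  simp [ofWord, add_mul, Finset.sum_add_distrib]

theorem ofWord_smul {m : ℕ → ℕ} {l : ℕ} (a : ZMod 4) (w : Word m l) :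
    ofWord (a • w) = (C a : P4) • ofWord w := by
  funext j
  change toBlk (m j) (∑ k : Fin (m j), C (a * w j k) * X ^ (k : ℕ))
    = toBlk (m j) (C a * ∑ k : Fin (m j), C (w j k) * X ^ (k : ℕ))
  rw [Finset.mul_sum]
  simp only [C_mul, mul_assoc]

/-- The dual code: the words that are orthogonal to every word of the code `D`, for the Euclidean
inner product. -/
noncomputable def dualCode {m : ℕ → ℕ} {l : ℕ} (D : Submodule P4 (Amb m l)) :
    Submodule P4 (Amb m l) where
  carrier := {d | ∃ w : Word m l, ofWord w = d ∧ ∀ v : Word m l, ofWord v ∈ D → dot w v = 0}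
  zero_mem' := ⟨0, by funext j; simp [ofWord], by simp [dot]⟩
  add_mem' := by
    rintro _ _ ⟨w, rfl, hw⟩ ⟨w', rfl, hw'⟩
    refine ⟨w + w', ofWord_add _ _, fun v hv => ?_⟩
    have : dot (w + w') v = dot w v + dot w' v := by
      simp [dot, add_mul, Finset.sum_add_distrib]
    rw [this, hw v hv, hw' v hv, add_zero]
  smul_mem' := by
    have hX : ∀ w : Word m l, (∀ v : Word m l, ofWord v ∈ D → dot w v = 0) →
        ∀ v : Word m l, ofWord v ∈ D → dot (shift w) v = 0 := by
      intro w hw v hv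
      let T : {u : Word m l // ofWord u ∈ D} → {u : Word m l // ofWord u ∈ D} :=
        fun u => ⟨shift u.1, by rw [ofWord_shift]; exact D.smul_mem _ u.2⟩
      have hT : Function.Injective T := fun u u' h =>
        Subtype.ext (shift_injective (congrArg Subtype.val h))
      obtain ⟨u, hu⟩ := (Finite.surjective_of_injective hT) ⟨v, hv⟩
      have hu' : shift u.1 = v := congrArg Subtype.val hu
      rw [← hu', dot_shift]
      exact hw _ u.2
    intro c d hd
    induction c using Polynomial.induction_on with
    | C a =>
      obtain ⟨w, rfl, hw⟩ := hd
      refine ⟨a • w, ofWord_smul _ _, fun v hv => ?_⟩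
      have : dot (a • w) v = a * dot w v := by
        simp [dot, Finset.mul_sum, mul_assoc]
      rw [this, hw v hv, mul_zero]
    | add p q hp hq =>
      obtain ⟨w, h1, hw⟩ := hp
      obtain ⟨w', h2, hw'⟩ := hq
      refine ⟨w + w', by rw [ofWord_add, h1, h2, add_smul], fun v hv => ?_⟩
      have : dot (w + w') v = dot w v + dot w' v := by
        simp [dot, add_mul, Finset.sum_add_distrib]
      rw [this, hw v hv, hw' v hv, add_zero]
    | monomial n a h =>
      obtain ⟨w, h1, hw⟩ := h
      refine ⟨shift w, ?_, hX w hw⟩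
      rw [ofWord_shift, h1, smul_smul]
      congr 1
      ring

/-- Row `r` of a matrix of polynomials, as an element of `R`. -/
noncomputable def row {m : ℕ → ℕ} (l : ℕ) (F : ℕ → ℕ → P4) (r : ℕ) : Amb m l :=
  fun j => toBlk (m j) (F r j)

/-- The rows `1, …, l` of `F` are a normalized generating set of the code `D`: they generate `D`,
the matrix is lower triangular, and `F_{r,r} = f + 2 g` with `g ∣ f ∣ x^{m_r} - 1`, `f` monic and `g` monic;
the term `2 g` may be absent. -/
structure IsNormalized {m : ℕ → ℕ} {l : ℕ} (D : Submodule P4 (Amb m l))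
    (F : ℕ → ℕ → P4) : Prop where
  span_eq : Submodule.span P4 {a | ∃ r ∈ Finset.Icc 1 l, a = row l F r} = D
  lower : ∀ r ∈ Finset.Icc 1 l, ∀ j ∈ Finset.Icc 1 l, r < j → F r j = 0
  diag : ∀ r ∈ Finset.Icc 1 l, ∃ f g : P4, f.Monic ∧ f ∣ X ^ m r - 1 ∧
    ((g.Monic ∧ g ∣ f) ∨ g = 0) ∧ F r r = f + 2 * g

/-- Truncation to the first `i` blocks. -/
noncomputable def trunc {m : ℕ → ℕ} {l i : ℕ} (h : i ≤ l) : Amb m l →ₗ[P4] Amb m i :=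
  LinearMap.pi fun j => LinearMap.proj
    (⟨j, Finset.mem_Icc.2 ⟨(Finset.mem_Icc.1 j.2).1, (Finset.mem_Icc.1 j.2).2.trans h⟩⟩ :
      Finset.Icc 1 l)

/-- The elimination process applied to row `r` of a lower triangular matrix `G`.
`H k r j` is the polynomial `G_{r,j}^{(k)}` (an element of `R_j`, given by a representative),
`A r (r-k)` is `A_{r,r-k}^{(k)}` and `B r (r-k)` is `B_{r,r-k}^{(k)}`. The process starts with `𝐠_r^{(0)} = 𝐠_r`.
At step `k + 1`, with `j = r - k - 1` and `d = gcd₄(G_{j,j}, G_{r,j}^{(k)})`, one sets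
`A_{r,j} = G_{j,j} / d`, `B_{r,j} = G_{r,j}^{(k)} / d` and `𝐠_r^{(k+1)} = A_{r,j} 𝐠_r^{(k)} - B_{r,j} 𝐠_j`.
All pivots `G_{r,r-k-1}^{(k)}`, `0 ≤ k ≤ r - 2`, are monic with reduction without multiple roots. -/
structure IsElimination (m : ℕ → ℕ) (G : ℕ → ℕ → P4)
    (H : ℕ → ℕ → ℕ → P4) (A B : ℕ → ℕ → P4) (r : ℕ) : Prop where
  start : ∀ j ∈ Finset.Icc 1 r, H 0 r j = G r j
  pivot : ∀ k, k + 2 ≤ r →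
    (H k r (r - k - 1)).Monic ∧ NoMultRoots (H k r (r - k - 1))
  quot : ∀ k, k + 2 ≤ r → ∃ d : P4,
    IsGcd4 (G (r - k - 1) (r - k - 1)) (H k r (r - k - 1)) d ∧
    G (r - k - 1) (r - k - 1) = A r (r - k - 1) * d ∧
    H k r (r - k - 1) = B r (r - k - 1) * d
  step : ∀ k, k + 2 ≤ r → ∀ j ∈ Finset.Icc 1 r,
    toBlk (m j) (H (k + 1) r j)
      = toBlk (m j) (A r (r - k - 1) * H k r j - B r (r - k - 1) * G (r - k - 1) j)
  step_diag : ∀ k, k + 2 ≤ r →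
    H (k + 1) r r = A r (r - k - 1) * H k r r

/-- The ring `ℤ₄[x]/⟨q⟩`, in which congruences modulo `q` are expressed. -/
abbrev Mod (q : P4) := P4 ⧸ Ideal.span {q}

/-- The residue class of `f` modulo `q`. -/
noncomputable abbrev cls (q f : P4) : Mod q := Ideal.Quotient.mk _ f

end GQC

/-!
Cyclic shifts preserve a GQC code and the inner product, so `e ∈ D^⊥` is orthogonal to every shift of
`d ∈ D`. With `M` a common multiple of the block lengths, this says
`∑_j e_j(x) d_j(x⁻¹) (x^M - 1)/(x^{m_j} - 1) = 0` in `ℤ₄[x]/⟨x^M - 1⟩` (`GQC.sum_mul_evalInv_eq_zero`).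
Row `i` of a triangular generating matrix of the dual code vanishes beyond block `i`, so the relation
only involves the first `i` blocks of `d`, i.e. the projected code.

Elimination in row `r` stays inside the projected code and ends with a codeword supported on block `r`
(`GQC.IsElimination.invariant`). Orthogonality to it gives the divisibility that defines `λ_r`
(`GQC.dvd_of_single_block`). One step earlier the codeword is supported on the blocks `1` and `s`, and
orthogonality to it, multiplied by `(A_{s,1})^*`, gives
`λ_1 (B_{s,1})^* x^a + λ_s x^c ≡ 0` modulo `(A_{s,1})^*`, where `a` and `c` are the degrees of the
components in the blocks `s` and `1` (`GQC.dvd_of_two_blocks`).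

The congruences follow, as `x` is invertible modulo the reciprocal of a monic polynomial and `3 = -1`.
The factor `x^{m'}` is harmless: `G_{1,1}` need not divide `x^{m_1} - 1`, but `(A_{s,1})^*` divides
`(x^{m_1} - 1) λ_1`, so `x^{m'} λ_1 ≡ λ_1`; the same argument serves `λ_i`. Finally
`(B_{i,1})^*` is invertible modulo `(A_{i,1})^*` because division by `gcd₄` leaves coprime quotients.
-/

namespace GQC

instance nontrivial_zmod_four : Nontrivial (ZMod 4) := ⟨0, 1, by decide⟩

/-! ### Correlation sums of periodic sequences -/

section Sums
variable {S : Type*} [CommRing S]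

/-- The sum over a full period does not depend on where the period starts. -/
theorem sum_range_add_of_periodic {M : ℕ} {f : ℕ → S} (hf : ∀ q, f (q + M) = f q) (b : ℕ) :
    ∑ p ∈ Finset.range M, f (b + p) = ∑ p ∈ Finset.range M, f p := by
  induction b with
  | zero => simp
  | succ b ih =>
    rw [← ih]
    have h1 := Finset.sum_range_succ (fun p => f (b + p)) M
    rw [Finset.sum_range_succ', hf b, add_zero] at h1
    simpa [add_assoc, add_comm, add_left_comm] using add_right_cancel h1

theorem sum_range_mul_of_periodic {n : ℕ} {a : ℕ → S} (ha : ∀ q, a (q + n) = a q) (u : S)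
    (t : ℕ) : ∑ q ∈ Finset.range (n * t), a q * u ^ q
      = (∑ q ∈ Finset.range n, a q * u ^ q) * ∑ c ∈ Finset.range t, u ^ (n * c) := by
  have ha' : ∀ c q, a (n * c + q) = a q := by
    intro c q
    induction c with
    | zero => simp
    | succ c ih => rw [← ih, ← ha (n * c + q)]; congr 1; ring
  induction t with
  | zero => simp
  | succ t ih =>
    rw [Nat.mul_succ, Finset.sum_range_add, ih, Finset.sum_range_succ, mul_add, add_right_inj,
      Finset.sum_mul]
    refine Finset.sum_congr rfl fun q _ => ?_
    rw [ha', pow_add]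
    ring

/-- The generating function of the correlations of an `n`-periodic sequence `a` with a finite
sequence `v` factors as `a(u) v(u⁻¹) (1 + u^n + u^{2n} + ⋯)` when `u ^ M = 1` with `n ∣ M`: the inner sum
over `p`, for fixed `k`, is `u^{-k}` times the sum of `a q * u ^ q` over a period of length `M`. -/
theorem sum_correlation {M n t : ℕ} (hM : M = n * t) (u : Sˣ) (hu : u ^ M = 1) {a : ℕ → S}
    (ha : ∀ q, a (q + n) = a q) (v : Fin n → S) :
    ∑ p ∈ Finset.range M, (∑ k : Fin n, a (k + p) * v k) * (u : S) ^ p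
      = (∑ q ∈ Finset.range n, a q * (u : S) ^ q) * (∑ k : Fin n, v k * ((u⁻¹ : Sˣ) : S) ^ (k : ℕ))
        * ∑ c ∈ Finset.range t, (u : S) ^ (n * c) := by
  have huM : (u : S) ^ M = 1 := by rw [← Units.val_pow_eq_pow_val, hu, Units.val_one]
  have hper : ∀ q, a (q + M) * (u : S) ^ (q + M) = a q * (u : S) ^ q := by
    intro q
    have : ∀ c, a (q + n * c) = a q := by
      intro c
      induction c with
      | zero => simp
      | succ c ih => rw [← ih, ← ha (q + n * c)]; congr 1; ring
    rw [pow_add, huM, mul_one, hM, this]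
  have hk : ∀ k : Fin n, ∑ p ∈ Finset.range M, a (k + p) * (u : S) ^ p
      = ((u⁻¹ : Sˣ) : S) ^ (k : ℕ) * ∑ q ∈ Finset.range M, a q * (u : S) ^ q := by
    intro k
    rw [← sum_range_add_of_periodic (f := fun q => a q * (u : S) ^ q) hper k, Finset.mul_sum]
    refine Finset.sum_congr rfl fun p _ => ?_
    have h1 : ((u⁻¹ : Sˣ) : S) ^ (k : ℕ) * (u : S) ^ (k : ℕ) = 1 := by
      rw [← mul_pow, Units.inv_mul, one_pow]
    rw [pow_add]
    linear_combination (-(a (k + p) * (u : S) ^ p)) * h1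
  have h2 : ∑ p ∈ Finset.range M, (∑ k : Fin n, a (k + p) * v k) * (u : S) ^ p
      = ∑ k : Fin n, v k * ∑ p ∈ Finset.range M, a (k + p) * (u : S) ^ p := by
    simp_rw [Finset.sum_mul, Finset.mul_sum]
    rw [Finset.sum_comm]
    exact Finset.sum_congr rfl fun _ _ => Finset.sum_congr rfl fun _ _ => by ring
  rw [h2]
  simp_rw [hk]
  rw [hM, sum_range_mul_of_periodic ha]
  simp_rw [← mul_assoc]
  rw [← Finset.sum_mul, ← Finset.sum_mul]
  ring

end Sums

/-! ### Evaluation at the inverse of `x` -/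

/-- The value `f(x⁻¹)` of a polynomial in a quotient of `ℤ₄[x]`; `u` is meant to be the class
of `x` there. -/
noncomputable def evalInv {I : Ideal P4} (u : (P4 ⧸ I)ˣ) : P4 →+* P4 ⧸ I :=
  eval₂RingHom ((Ideal.Quotient.mk I).comp C) ((u⁻¹ : (P4 ⧸ I)ˣ) : P4 ⧸ I)

theorem evalInv_X {I : Ideal P4} (u : (P4 ⧸ I)ˣ) : evalInv u X = ((u⁻¹ : (P4 ⧸ I)ˣ) : P4 ⧸ I) := by
  simp [evalInv]

theorem mk_eq_eval₂ (I : Ideal P4) (f : P4) :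
    Ideal.Quotient.mk I f
      = f.eval₂ ((Ideal.Quotient.mk I).comp C) (Ideal.Quotient.mk I X) := by
  rw [← Polynomial.hom_eval₂, eval₂_C_X]

/-- The reciprocal polynomial is `x^{deg f} f(x⁻¹)`. -/
theorem evalInv_mul_pow {I : Ideal P4} (u : (P4 ⧸ I)ˣ) (hu : (u : P4 ⧸ I) = Ideal.Quotient.mk I X)
    (f : P4) : evalInv u f * (u : P4 ⧸ I) ^ f.natDegree = Ideal.Quotient.mk I f.reverse := by
  have h := eval₂_reverse_mul_pow ((Ideal.Quotient.mk I).comp C) ((u⁻¹ : (P4 ⧸ I)ˣ) : P4 ⧸ I) f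
  rw [invOf_units, inv_inv, hu, ← mk_eq_eval₂] at h
  change _ = evalInv u f at h
  rw [← h, mul_assoc, ← mul_pow, Units.inv_mul, one_pow, mul_one]

/-- The class of `x` modulo `x^M - 1`, as a unit. -/
theorem exists_unit_X {M : ℕ} (hM : 0 < M) :
    ∃ u : (Blk M)ˣ, (u : Blk M) = toBlk M X ∧ u ^ M = 1 := by
  have h : (toBlk M X) ^ M = 1 := by
    rw [← map_pow, ← sub_eq_zero, ← map_one (Ideal.Quotient.mk _), ← map_sub]
    exact Ideal.Quotient.eq_zero_iff_mem.2 (Ideal.mem_span_singleton_self _)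
  exact ⟨Units.ofPowEqOne _ M h hM.ne', rfl, Units.ext (by simp)⟩

/-! ### Polynomial orthogonality relation of the dual code -/

theorem toBlk_sub (n : ℕ) (f g : P4) : toBlk n (f - g) = toBlk n f - toBlk n g := rfl

theorem toBlk_mul (n : ℕ) (f g : P4) : toBlk n (f * g) = toBlk n f * toBlk n g := rfl

theorem toBlk_eq_zero_iff {n : ℕ} {f : P4} : toBlk n f = 0 ↔ X ^ n - 1 ∣ f := by
  rw [Ideal.Quotient.eq_zero_iff_mem, Ideal.mem_span_singleton]

theorem toBlk_eq_iff {n : ℕ} {f g : P4} : toBlk n f = toBlk n g ↔ X ^ n - 1 ∣ f - g := by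
  rw [Ideal.Quotient.eq, Ideal.mem_span_singleton]

theorem ofWord_surjective {m : ℕ → ℕ} {l : ℕ} (hm : ∀ j ∈ Finset.Icc 1 l, 0 < m j) :
    Function.Surjective (ofWord (m := m) (l := l)) := by
  intro d
  have h : ∀ j : Finset.Icc 1 l, ∃ w : Fin (m j) → ZMod 4,
      toBlk (m j) (∑ k : Fin (m j), C (w k) * X ^ (k : ℕ)) = d j := by
    intro j
    obtain ⟨f, hf⟩ := Ideal.Quotient.mk_surjective (d j)
    have hmon : (X ^ m j - 1 : P4).Monic := monic_X_pow_sub_C 1 (hm j j.2).ne'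
    refine ⟨fun k => (f %ₘ (X ^ m j - 1)).coeff k, ?_⟩
    have hdeg : (f %ₘ (X ^ m j - 1)).natDegree < m j := by
      have := natDegree_modByMonic_lt f hmon (by
        intro h1
        have := congrArg natDegree h1
        rw [← C_1, natDegree_X_pow_sub_C, natDegree_C] at this
        exact (hm j j.2).ne' this)
      rwa [← C_1, natDegree_X_pow_sub_C] at this
    rw [Fin.sum_univ_eq_sum_range (fun k => C ((f %ₘ (X ^ m j - 1)).coeff k) * X ^ k) (m j),
      ← as_sum_range_C_mul_X_pow' _ hdeg, ← hf]
    refine toBlk_eq_iff.2 ⟨-(f /ₘ (X ^ m j - 1)), ?_⟩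
    linear_combination modByMonic_add_div f (X ^ m j - 1)
  choose w hw using h
  exact ⟨w, funext hw⟩

/-- The polynomial `(x^M - 1) / (x^n - 1) = 1 + x^n + x^{2n} + ⋯`, for `n ∣ M`. Multiplication by it
embeds `ℤ₄[x]/⟨x^n - 1⟩` into `ℤ₄[x]/⟨x^M - 1⟩`. -/
noncomputable def cofactor (n M : ℕ) : P4 := ∑ c ∈ Finset.range (M / n), X ^ (n * c)

theorem cofactor_mul {n M : ℕ} (h : n ∣ M) : cofactor n M * (X ^ n - 1) = X ^ M - 1 := by
  simp only [cofactor, pow_mul]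
  rw [geom_sum_mul, ← pow_mul, Nat.mul_div_cancel' h]

theorem val_finRotate (n : ℕ) (k : Fin n) : ((finRotate n k : Fin n) : ℕ) = (k + 1) % n := by
  cases n with
  | zero => exact k.elim0
  | succ n => rw [finRotate_apply, Fin.val_add, Fin.val_one', Nat.add_mod_mod]

/-- A word orthogonal to a code stays orthogonal to it after any number `p` of inverse cyclic
shifts; the shifted word is written through the periodic extension of each block. -/
theorem sum_periodic_eq_zero {m : ℕ → ℕ} {l : ℕ} (hm : ∀ j : Finset.Icc 1 l, 0 < m j)
    {D : Submodule P4 (Amb m l)} {w : Word m l}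
    (hw : ∀ v : Word m l, ofWord v ∈ D → dot w v = 0) (p : ℕ) :
    ∀ v : Word m l, ofWord v ∈ D →
      ∑ j : Finset.Icc 1 l, ∑ k : Fin (m j), w j ⟨(k + p) % m j, Nat.mod_lt _ (hm j)⟩ * v j k = 0 := by
  induction p with
  | zero =>
    intro v hv
    simpa [dot, Nat.mod_eq_of_lt] using hw v hv
  | succ p ih =>
    intro v hv
    have h := ih (shift v) (by rw [ofWord_shift]; exact D.smul_mem _ hv)
    rw [← h]
    refine Finset.sum_congr rfl fun j _ => ?_
    rw [← Equiv.sum_comp (finRotate (m j)) fun k : Fin (m j) =>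
      w j ⟨(k + p) % m j, Nat.mod_lt _ (hm j)⟩ * shift v j k]
    refine Finset.sum_congr rfl fun k _ => ?_
    simp only [shift, Equiv.symm_apply_apply]
    congr 2
    rw [Fin.mk.injEq, val_finRotate, Nat.mod_add_mod]
    congr 1
    ring

/-- For `e ∈ D^⊥` and `d ∈ D`, the inner products of `d` with all cyclic shifts of `e` vanish. Collected
as the coefficients of one element of `ℤ₄[x]/⟨x^M - 1⟩`, where all `m_j` divide `M`, they give
`∑_j e_j(x) d_j(x⁻¹) (x^M - 1)/(x^{m_j} - 1) = 0`, for arbitrary representatives of `e_j` and `d_j`. -/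
theorem sum_mul_evalInv_eq_zero {m : ℕ → ℕ} {l M : ℕ} (hm : ∀ j ∈ Finset.Icc 1 l, 0 < m j)
    (hM : ∀ j ∈ Finset.Icc 1 l, m j ∣ M) {D : Submodule P4 (Amb m l)} {e d : Amb m l}
    (he : e ∈ dualCode D) (hd : d ∈ D) {a c : Finset.Icc 1 l → P4}
    (ha : ∀ j, e j = toBlk (m j) (a j)) (hc : ∀ j, d j = toBlk (m j) (c j))
    (u : (Blk M)ˣ) (hu : (u : Blk M) = toBlk M X) (huM : u ^ M = 1) :
    ∑ j : Finset.Icc 1 l, toBlk M (a j) * evalInv u (c j) * toBlk M (cofactor (m j) M) = 0 := by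
  obtain ⟨w, rfl, hw⟩ := he
  obtain ⟨v, rfl⟩ := ofWord_surjective hm d
  have hm' : ∀ j : Finset.Icc 1 l, 0 < m j := fun j => hm j j.2
  have key : ∑ p ∈ Finset.range M, toBlk M (C (∑ j : Finset.Icc 1 l, ∑ k : Fin (m j),
      w j ⟨(k + p) % m j, Nat.mod_lt _ (hm' j)⟩ * v j k)) * (u : Blk M) ^ p = 0 := by
    refine Finset.sum_eq_zero fun p _ => ?_
    rw [sum_periodic_eq_zero hm' hw p v hd]
    simp
  rw [← key]
  simp_rw [map_sum, Finset.sum_mul]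
  rw [Finset.sum_comm]
  refine Finset.sum_congr rfl fun j _ => ?_
  have h1 := sum_correlation (Nat.mul_div_cancel' (hM j j.2)).symm u huM
    (a := fun q => toBlk M (C (w j ⟨q % m j, Nat.mod_lt _ (hm' j)⟩)))
    (fun q => by simp only [Nat.add_mod_right]) (fun k => toBlk M (C (v j k)))
  simp_rw [← Finset.sum_mul, map_mul]
  rw [h1]
  have hz : toBlk M (cofactor (m j) M) * (toBlk M (X ^ m j - 1)) = 0 := by
    rw [← map_mul, cofactor_mul (hM j j.2)]
    exact toBlk_eq_zero_iff.2 dvd_rfl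
  have hcof : ∑ t ∈ Finset.range (M / m j), (u : Blk M) ^ (m j * t)
      = toBlk M (cofactor (m j) M) := by
    simp [cofactor, hu]
  have hW : ∑ q ∈ Finset.range (m j), toBlk M (C (w j ⟨q % m j, Nat.mod_lt _ (hm' j)⟩))
      * (u : Blk M) ^ q = toBlk M (∑ k : Fin (m j), C (w j k) * X ^ (k : ℕ)) := by
    rw [← Fin.sum_univ_eq_sum_range
      (fun q => toBlk M (C (w j ⟨q % m j, Nat.mod_lt _ (hm' j)⟩)) * (u : Blk M) ^ q)]
    simp [hu, Nat.mod_eq_of_lt]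
  have hV : ∑ k : Fin (m j), toBlk M (C (v j k)) * ((u⁻¹ : (Blk M)ˣ) : Blk M) ^ (k : ℕ)
      = evalInv u (∑ k : Fin (m j), C (v j k) * X ^ (k : ℕ)) := by
    simp [evalInv]
  rw [hcof, hW, hV]
  obtain ⟨y, hy⟩ := toBlk_eq_iff.1 (ha j)
  obtain ⟨z, hz'⟩ := toBlk_eq_iff.1 (hc j)
  have hy' := congrArg (toBlk M) hy
  have hz'' := congrArg (evalInv u) hz'
  rw [map_sub, map_mul] at hz''
  rw [toBlk_sub, toBlk_mul] at hy'
  -- `x^{-n} - 1` is an associate of `x^n - 1`, so the factor `cofactor n M` kills the ambiguity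
  -- of both representatives
  have hconj : evalInv u (X ^ m j - 1)
      = -((u⁻¹ : (Blk M)ˣ) : Blk M) ^ m j * toBlk M (X ^ m j - 1) := by
    have h3 : ((u⁻¹ : (Blk M)ˣ) : Blk M) ^ m j * (u : Blk M) ^ m j = 1 := by
      rw [← mul_pow, Units.inv_mul, one_pow]
    rw [map_sub, map_pow, map_one, evalInv_X, toBlk_sub]
    simp only [toBlk, map_pow, map_one, ← hu]
    linear_combination h3
  rw [hconj] at hz''
  set Z := toBlk M (cofactor (m j) M)
  set W := toBlk M (∑ k : Fin (m j), C (w j k) * X ^ (k : ℕ))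
  set V := evalInv u (∑ k : Fin (m j), C (v j k) * X ^ (k : ℕ))
  linear_combination (-V * Z) * hy' - (toBlk M (a j)) * Z * hz''
    + (-V * toBlk M y + toBlk M (a j) * ((u⁻¹ : (Blk M)ˣ) : Blk M) ^ m j * evalInv u z) * hz

/-- The orthogonality relation for a codeword of the projection to the first `i` blocks: a dual
word that vanishes beyond block `i` does not see the other components of a lift. -/
theorem sum_mul_evalInv_eq_zero_of_trunc {m : ℕ → ℕ} {l i M : ℕ}
    (hm : ∀ j ∈ Finset.Icc 1 l, 0 < m j) (hM : ∀ j ∈ Finset.Icc 1 l, m j ∣ M) (hil : i ≤ l)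
    {D : Submodule P4 (Amb m l)} {a c : ℕ → P4}
    (ha : (fun j : Finset.Icc 1 l => toBlk (m j) (a j)) ∈ dualCode D)
    (ha0 : ∀ j ∈ Finset.Icc 1 l, i < j → a j = 0)
    (hc : (fun j : Finset.Icc 1 i => toBlk (m j) (c j)) ∈ D.map (trunc hil))
    (u : (Blk M)ˣ) (hu : (u : Blk M) = toBlk M X) (huM : u ^ M = 1) :
    ∑ j ∈ Finset.Icc 1 i, toBlk M (a j) * evalInv u (c j) * toBlk M (cofactor (m j) M) = 0 := by
  obtain ⟨d, hd, hdc⟩ := hc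
  have hrep : ∀ j : Finset.Icc 1 l, ∃ f, toBlk (m j) f = d j :=
    fun j => Ideal.Quotient.mk_surjective (d j)
  choose f hf using hrep
  have h := sum_mul_evalInv_eq_zero hm hM ha hd (a := fun j => a j)
    (c := fun j => if (j : ℕ) ≤ i then c j else f j) (fun j => rfl) (fun j => by
      split_ifs with hj
      · exact congrFun hdc ⟨j, Finset.mem_Icc.2 ⟨(Finset.mem_Icc.1 j.2).1, hj⟩⟩
      · exact (hf j).symm) u hu huM
  have hsub : Finset.Icc 1 i ⊆ Finset.Icc 1 l := Finset.Icc_subset_Icc_right hil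
  rw [← h, ← Finset.sum_coe_sort]
  have hinj : Function.Injective (fun j : Finset.Icc 1 i => (⟨j, hsub j.2⟩ : Finset.Icc 1 l)) :=
    fun j k hjk => Subtype.ext (congrArg (fun t : Finset.Icc 1 l => (t : ℕ)) hjk)
  refine Fintype.sum_of_injective _ hinj _ _ (fun j hj => ?_) (fun j => ?_)
  · have hji : i < j := by
      by_contra hle
      exact hj ⟨⟨j, Finset.mem_Icc.2 ⟨(Finset.mem_Icc.1 j.2).1, not_lt.1 hle⟩⟩, rfl⟩
    simp only [ha0 j j.2 hji]
    simp
  · simp only [if_pos (Finset.mem_Icc.1 j.2).2]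

/-! ### Monic polynomials, reciprocals and `gcd₄` -/

theorem monic_X_pow_sub_one {n : ℕ} (hn : 0 < n) : (X ^ n - 1 : P4).Monic :=
  monic_X_pow_sub_C 1 hn.ne'

theorem reverse_mul_of_monic {f g : P4} (hf : f.Monic) (hg : g.Monic) :
    (f * g).reverse = f.reverse * g.reverse :=
  Polynomial.reverse_mul (by rw [hf.leadingCoeff, hg.leadingCoeff, one_mul]; exact one_ne_zero)

/-- Division by `d = gcd₄(f, g)` is well defined since `d` is monic, and the quotients are the products
over `S ∖ T` and `T ∖ S`, hence monic and coprime. -/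
theorem IsGcd4.monic_and_isCoprime {f g d a b : P4} (h : IsGcd4 f g d) (hf : f = a * d)
    (hg : g = b * d) : a.Monic ∧ b.Monic ∧ d.Monic ∧ IsCoprime a b := by
  classical
  obtain ⟨S, T, hirr, hcop, hfS, hgT, hd⟩ := h
  have hd' : d = ∏ h ∈ S ∩ T, h := by rw [hd]
  have hmon : ∀ U ⊆ S ∪ T, (∏ h ∈ U, h : P4).Monic := fun U hU =>
    monic_prod_of_monic _ _ fun h hh => (hirr h (by have := hU hh; convert this)).1
  have hdm : d.Monic := hd' ▸ hmon _ (Finset.inter_subset_left.trans Finset.subset_union_left)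
  have ha : a = ∏ h ∈ S \ T, h := by
    refine hdm.isRegular.right ?_
    change a * d = _ * d
    rw [← hf, hfS, hd', ← Finset.prod_inter_mul_prod_sdiff S T, mul_comm]
  have hb : b = ∏ h ∈ T \ S, h := by
    refine hdm.isRegular.right ?_
    change b * d = _ * d
    rw [← hg, hgT, hd', ← Finset.prod_inter_mul_prod_sdiff T S, mul_comm, Finset.inter_comm]
  refine ⟨ha ▸ hmon _ (Finset.sdiff_subset.trans Finset.subset_union_left),
    hb ▸ hmon _ (Finset.sdiff_subset.trans Finset.subset_union_right), hdm, ?_⟩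
  rw [ha, hb]
  refine IsCoprime.prod_left fun h hh => IsCoprime.prod_right fun h' hh' => ?_
  rw [Finset.mem_sdiff] at hh hh'
  refine hcop h (by simp [hh.1]) h' (by simp [hh'.1]) ?_
  rintro rfl
  exact hh.2 hh'.1

/-- The constant term of the reciprocal of a monic polynomial is `1`, so `x` is invertible modulo it. -/
theorem exists_unit_cls_X {a : P4} (ha : a.Monic) :
    ∃ u : (Mod a.reverse)ˣ, (u : Mod a.reverse) = cls a.reverse X := by
  have h : X * a.reverse.divX + 1 = a.reverse := by
    have := X_mul_divX_add a.reverse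
    rwa [coeff_zero_reverse, ha.leadingCoeff, C_1] at this
  have h1 : cls a.reverse X * cls a.reverse (-a.reverse.divX) = 1 := by
    rw [← map_mul, ← map_one (Ideal.Quotient.mk _), Ideal.Quotient.eq,
      Ideal.mem_span_singleton]
    exact ⟨-1, by linear_combination -h⟩
  exact ⟨(IsUnit.of_mul_eq_one _ h1).unit, rfl⟩

/-- Modulo `a^*` one has `a(x⁻¹) = 0`, so a Bézout relation for `a` and `b`, evaluated at `x⁻¹`, makes
`b(x⁻¹)` invertible. -/
theorem isUnit_cls_reverse {a b : P4} (ha : a.Monic) (hab : IsCoprime a b) :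
    IsUnit (cls a.reverse b.reverse) := by
  obtain ⟨u, hu⟩ := exists_unit_cls_X ha
  have h0 : evalInv u a = 0 := by
    have h := evalInv_mul_pow u hu a
    rw [Ideal.Quotient.eq_zero_iff_mem.2 (Ideal.mem_span_singleton_self _)] at h
    exact (Units.mul_left_eq_zero (u ^ a.natDegree)).1 (by simpa using h)
  have h1 := hab.map (evalInv u)
  rw [h0, isCoprime_zero_left] at h1
  rw [cls, ← evalInv_mul_pow u hu b]
  exact h1.mul (u.isUnit.pow _)

/-! ### Elimination -/

section Elimination

variable {m : ℕ → ℕ} {i r : ℕ} {D : Submodule P4 (Amb m i)} {G : ℕ → ℕ → P4}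
  {H : ℕ → ℕ → ℕ → P4} {A B : ℕ → ℕ → P4}

theorem IsNormalized.row_mem (hG : IsNormalized D G) (hr : r ∈ Finset.Icc 1 i) :
    row i G r ∈ D :=
  hG.span_eq ▸ Submodule.subset_span ⟨r, hr, rfl⟩

/-- After `k` steps the row is still a codeword, its diagonal entry is monic, and the `k` components
to the left of the diagonal vanish. -/
theorem IsElimination.invariant (hG : IsNormalized D G)
    (hGm : ∀ r ∈ Finset.Icc 1 i, (G r r).Monic) (hr : r ∈ Finset.Icc 1 i)
    (h : IsElimination m G H A B r) (k : ℕ) (hk : k + 1 ≤ r) :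
    (H k r r).Monic ∧ (∀ j, r - k ≤ j → j < r → toBlk (m j) (H k r j) = 0) ∧
      (fun j : Finset.Icc 1 i => toBlk (m j) (if (j : ℕ) ≤ r then H k r j else 0)) ∈ D := by
  obtain ⟨hr1, hri⟩ := Finset.mem_Icc.1 hr
  induction k with
  | zero =>
    refine ⟨?_, fun j h1 h2 => by omega, ?_⟩
    · rw [h.start r (Finset.mem_Icc.2 ⟨hr1, le_rfl⟩)]
      exact hGm r hr
    · convert hG.row_mem hr using 1
      funext j
      have hj1 := (Finset.mem_Icc.1 j.2).1
      unfold row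
      split_ifs with hj
      · rw [h.start j (Finset.mem_Icc.2 ⟨hj1, hj⟩)]
      · rw [hG.lower r hr j j.2 (not_le.1 hj)]
  | succ k ih =>
    obtain ⟨hmon, hzero, hmem⟩ := ih (by omega)
    obtain ⟨p, hp⟩ : ∃ p, p = r - k - 1 := ⟨_, rfl⟩
    have hpi : p ∈ Finset.Icc 1 i := Finset.mem_Icc.2 (by omega)
    obtain ⟨d, hd, hGd, hHd⟩ := h.quot k hk
    have hA := (hd.monic_and_isCoprime hGd hHd).1
    have hstep := h.step k hk
    rw [← hp] at hGd hHd hA hstep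
    refine ⟨?_, fun j h1 h2 => ?_, ?_⟩
    · rw [h.step_diag k hk, ← hp]
      exact hA.mul hmon
    · rw [hstep j (Finset.mem_Icc.2 (by omega))]
      -- component `p` becomes `(A B - B A) d`; beyond `p`, row `p` of `G` is zero
      obtain hj | hj : j = p ∨ p < j := by omega
      · rw [hj, hGd, hHd, toBlk_eq_zero_iff]
        exact ⟨0, by ring⟩
      · rw [hG.lower p hpi j (Finset.mem_Icc.2 (by omega)) hj, mul_zero, sub_zero, toBlk_mul,
          hzero j (by omega) h2, mul_zero]
    · convert D.sub_mem (D.smul_mem (A r p) hmem) (D.smul_mem (B r p) (hG.row_mem hpi)) using 1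
      funext j
      have hj1 := (Finset.mem_Icc.1 j.2).1
      change _ = toBlk (m j) (A r p * (if (j : ℕ) ≤ r then H k r j else 0) - B r p * G p j)
      split_ifs with hj
      · exact hstep j (Finset.mem_Icc.2 ⟨hj1, hj⟩)
      · rw [hG.lower p hpi j j.2 (by omega), mul_zero, mul_zero, sub_zero]

/-- At the end of the elimination only component `r` is left. -/
theorem IsElimination.last_mem (hG : IsNormalized D G)
    (hGm : ∀ r ∈ Finset.Icc 1 i, (G r r).Monic) (hr : r ∈ Finset.Icc 1 i)
    (h : IsElimination m G H A B r) :
    (fun j : Finset.Icc 1 i => toBlk (m j) (if (j : ℕ) = r then H (r - 1) r r else 0)) ∈ D := by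
  obtain ⟨hr1, hri⟩ := Finset.mem_Icc.1 hr
  obtain ⟨-, hz, hmem⟩ := h.invariant hG hGm hr (r - 1) (by omega)
  convert hmem using 2 with j
  have hj1 := (Finset.mem_Icc.1 j.2).1
  obtain hj | hj | hj := lt_trichotomy (j : ℕ) r
  · rw [if_neg hj.ne, if_pos hj.le, hz j (by omega) hj, toBlk_eq_zero_iff]
    exact dvd_zero _
  · rw [if_pos hj, if_pos hj.le, hj]
  · rw [if_neg hj.ne', if_neg hj.not_ge]

/-- One step before the end only the components `1` and `r` are left. -/
theorem IsElimination.penultimate_mem (hG : IsNormalized D G)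
    (hGm : ∀ r ∈ Finset.Icc 1 i, (G r r).Monic) (hr : r ∈ Finset.Icc 1 i) (hr2 : 2 ≤ r)
    (h : IsElimination m G H A B r) :
    (fun j : Finset.Icc 1 i => toBlk (m j)
      (if (j : ℕ) = r then H (r - 2) r r else if (j : ℕ) = 1 then H (r - 2) r 1 else 0)) ∈ D := by
  obtain ⟨hr1, hri⟩ := Finset.mem_Icc.1 hr
  obtain ⟨-, hz, hmem⟩ := h.invariant hG hGm hr (r - 2) (by omega)
  convert hmem using 2 with j
  have hj1 := (Finset.mem_Icc.1 j.2).1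
  obtain hj | hj | hj := lt_trichotomy (j : ℕ) r
  · rw [if_neg hj.ne, if_pos hj.le]
    split_ifs with hj'
    · rw [hj']
    · rw [hz j (by omega) hj, toBlk_eq_zero_iff]
      exact dvd_zero _
  · rw [if_pos hj, if_pos hj.le, hj]
  · rw [if_neg hj.ne', if_neg hj.not_ge, if_neg (by omega)]

end Elimination

/-! ### Dual words against codewords with one or two nonzero blocks -/

section Blocks

variable {m : ℕ → ℕ} {l i r s M : ℕ} {D : Submodule P4 (Amb m l)} {hil : i ≤ l} {a : ℕ → P4}

theorem dvd_of_single_block (hm : ∀ j ∈ Finset.Icc 1 l, 0 < m j)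
    (ha : (fun j : Finset.Icc 1 l => toBlk (m j) (a j)) ∈ dualCode D)
    (ha0 : ∀ j ∈ Finset.Icc 1 l, i < j → a j = 0) (hr : r ∈ Finset.Icc 1 i) {c : P4}
    (hc : (fun j : Finset.Icc 1 i => toBlk (m j) (if (j : ℕ) = r then c else 0))
      ∈ D.map (trunc hil)) :
    X ^ m r - 1 ∣ a r * c.reverse := by
  obtain ⟨hr1, hri⟩ := Finset.mem_Icc.1 hr
  have hrl : r ∈ Finset.Icc 1 l := Finset.mem_Icc.2 ⟨hr1, hri.trans hil⟩
  set M := ∏ j ∈ Finset.Icc 1 l, m j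
  have hM0 : 0 < M := Finset.prod_pos hm
  have hM : ∀ j ∈ Finset.Icc 1 l, m j ∣ M := fun j hj => Finset.dvd_prod_of_mem m hj
  obtain ⟨u, hu, huM⟩ := exists_unit_X hM0
  have h := sum_mul_evalInv_eq_zero_of_trunc hm hM hil
    (c := fun j => if j = r then c else 0) ha ha0 hc u hu huM
  rw [Finset.sum_eq_single r (fun j _ hj => by simp [hj]) (fun hn => absurd hr hn),
    if_pos rfl] at h
  have h1 : toBlk M (a r * c.reverse * cofactor (m r) M) = 0 := by
    simp only [toBlk, map_mul]
    rw [← evalInv_mul_pow u hu c]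
    linear_combination (u : Blk M) ^ c.natDegree * h
  obtain ⟨q, hq⟩ := toBlk_eq_zero_iff.1 h1
  refine ⟨q, (monic_X_pow_sub_one hM0).isRegular.left ?_⟩
  change (X ^ M - 1) * _ = (X ^ M - 1) * _
  linear_combination (X ^ m r - 1) * hq - a r * c.reverse * cofactor_mul (hM r hrl)

/-- Orthogonality to a codeword supported on the blocks `1` and `s` links the two quotients `l₁` and
`lₛ` modulo `p^*`: multiplied by `p^*`, both terms of the orthogonality relation become multiples of
`x^M - 1`, which is then cancelled. -/
theorem dvd_of_two_blocks (hm : ∀ j ∈ Finset.Icc 1 l, 0 < m j)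
    (ha : (fun j : Finset.Icc 1 l => toBlk (m j) (a j)) ∈ dualCode D)
    (ha0 : ∀ j ∈ Finset.Icc 1 l, i < j → a j = 0) (hs : s ∈ Finset.Icc 2 i) {p c₁ cₛ b d l₁ lₛ : P4}
    (hp : p.Monic) (hb : b.Monic) (hd : d.Monic) (hcs : cₛ.Monic)
    (hc : (fun j : Finset.Icc 1 i => toBlk (m j) (if (j : ℕ) = s then cₛ else
      if (j : ℕ) = 1 then c₁ else 0)) ∈ D.map (trunc hil)) (hc₁ : c₁ = b * d)
    (h₁ : a 1 * (p * d).reverse = (X ^ m 1 - 1) * l₁)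
    (hₛ : a s * (p * cₛ).reverse = (X ^ m s - 1) * lₛ) :
    p.reverse ∣ l₁ * b.reverse * X ^ cₛ.natDegree + lₛ * X ^ c₁.natDegree := by
  obtain ⟨hs2, hsi⟩ := Finset.mem_Icc.1 hs
  have hsl : s ∈ Finset.Icc 1 l := Finset.mem_Icc.2 (by omega)
  have h1l : 1 ∈ Finset.Icc 1 l := Finset.mem_Icc.2 (by omega)
  set M := ∏ j ∈ Finset.Icc 1 l, m j
  have hM0 : 0 < M := Finset.prod_pos hm
  have hM : ∀ j ∈ Finset.Icc 1 l, m j ∣ M := fun j hj => Finset.dvd_prod_of_mem m hj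
  obtain ⟨u, hu, huM⟩ := exists_unit_X hM0
  have h := sum_mul_evalInv_eq_zero_of_trunc hm hM hil
    (c := fun j => if j = s then cₛ else if j = 1 then c₁ else 0) ha ha0 hc u hu huM
  have hs1 : 1 ≠ s := by omega
  rw [Finset.sum_eq_add 1 s hs1 (fun j _ hj => by simp [hj.1, hj.2])
    (fun hn => absurd (Finset.mem_Icc.2 (by omega)) hn)
    (fun hn => absurd (Finset.mem_Icc.2 (by omega)) hn), if_pos rfl, if_neg hs1, if_pos rfl] at h
  have h1 : toBlk M (a 1 * c₁.reverse * cofactor (m 1) M * X ^ cₛ.natDegree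
      + a s * cₛ.reverse * cofactor (m s) M * X ^ c₁.natDegree) = 0 := by
    simp only [toBlk, map_add, map_mul, map_pow]
    rw [← evalInv_mul_pow u hu c₁, ← evalInv_mul_pow u hu cₛ]
    simp only [toBlk] at hu
    rw [← hu]
    linear_combination (u : Blk M) ^ c₁.natDegree * (u : Blk M) ^ cₛ.natDegree * h
  obtain ⟨q, hq⟩ := toBlk_eq_zero_iff.1 h1
  rw [reverse_mul_of_monic hp hd] at h₁
  rw [reverse_mul_of_monic hp hcs] at hₛ
  rw [hc₁, reverse_mul_of_monic hb hd, ← hc₁] at hq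
  refine ⟨q, (monic_X_pow_sub_one hM0).isRegular.left ?_⟩
  change (X ^ M - 1) * _ = (X ^ M - 1) * _
  linear_combination p.reverse * hq - b.reverse * X ^ cₛ.natDegree * cofactor (m 1) M * h₁
    - X ^ c₁.natDegree * cofactor (m s) M * hₛ
    - l₁ * b.reverse * X ^ cₛ.natDegree * cofactor_mul (hM 1 h1l)
    - lₛ * X ^ c₁.natDegree * cofactor_mul (hM s hsl)

end Blocks

/-! ### Congruences modulo a reciprocal polynomial -/

/-- A two-term relation solved for `y`; the exponent may be raised by any `N` with `x * u ^ N = x`. -/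
theorem eq_neg_mul_zpow {R : Type*} [CommRing R] (u : Rˣ) {x y : R} {N a c : ℕ}
    (h : x * (u : R) ^ a + y * (u : R) ^ c = 0) (hx : x * (u : R) ^ N = x) :
    y = -(x * ((u ^ ((N : ℤ) + a - c) : Rˣ) : R)) := by
  have h1 : ((u ^ ((N : ℤ) + a - c) : Rˣ) : R) * (u : R) ^ c = (u : R) ^ N * (u : R) ^ a := by
    have : u ^ ((N : ℤ) + a - c) * u ^ c = u ^ N * u ^ a := by
      rw [← zpow_natCast u c, ← zpow_add, sub_add_cancel, zpow_add, zpow_natCast, zpow_natCast]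
    simpa using congrArg (Units.val) this
  refine (u.isUnit.pow c).mul_right_cancel ?_
  linear_combination h + x * h1 + (u : R) ^ a * hx

/-- If `q ∣ (x^n - 1) f`, then `x^N` acts as the identity on `f` modulo `q` for `n ∣ N`. No divisibility
`q ∣ x^n - 1` is needed. -/
theorem cls_mul_pow_eq {q f : P4} {n N : ℕ} (hn : n ∣ N) (h : q ∣ (X ^ n - 1) * f)
    (u : (Mod q)ˣ) (hu : (u : Mod q) = cls q X) : cls q f * (u : Mod q) ^ N = cls q f := by
  rw [hu, ← map_pow, ← map_mul, Ideal.Quotient.eq, Ideal.mem_span_singleton]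
  obtain ⟨t, rfl⟩ := hn
  have h1 : (X ^ n - 1 : P4) ∣ X ^ (n * t) - 1 := by
    simpa [pow_mul] using sub_dvd_pow_sub_pow (X ^ n : P4) 1 t
  refine (h.trans (mul_dvd_mul_right h1 f)).trans (dvd_of_eq (by ring))

theorem three_eq_neg_one (q : P4) : (3 : Mod q) = -1 := by
  have h := congrArg (fun c : ZMod 4 => cls q (C c)) (show (3 : ZMod 4) = -1 by decide)
  simpa only [map_neg, map_one, map_ofNat] using h

/-- The last step eliminates component `1`, against the diagonal entry `G 1 1`. -/
theorem IsElimination.exists_last_step {m : ℕ → ℕ} {r : ℕ} {G : ℕ → ℕ → P4}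
    {H : ℕ → ℕ → ℕ → P4} {A B : ℕ → ℕ → P4} (h : IsElimination m G H A B r) (hr : 2 ≤ r) :
    H (r - 1) r r = A r 1 * H (r - 2) r r ∧ ∃ d, d.Monic ∧ (A r 1).Monic ∧ (B r 1).Monic ∧
      IsCoprime (A r 1) (B r 1) ∧ G 1 1 = A r 1 * d ∧ H (r - 2) r 1 = B r 1 * d := by
  obtain ⟨t, rfl⟩ := Nat.exists_eq_add_of_le' hr
  have ht : t + 2 - t - 1 = 1 := by omega
  have hdiag := h.step_diag t le_rfl
  obtain ⟨d, hd, hG, hH⟩ := h.quot t le_rfl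
  obtain ⟨hA, hB, hdm, hcop⟩ := hd.monic_and_isCoprime hG hH
  rw [ht] at hdiag hG hH hA hB hcop
  exact ⟨hdiag, d, hdm, hA, hB, hcop, hG, hH⟩

end GQC

open GQC in
theorem proposition5 (l : ℕ) (m : ℕ → ℕ)
    (hm : ∀ j ∈ Finset.Icc 1 l, Odd (m j))
    (D : Submodule GQC.P4 (GQC.Amb m l))
    (F E : ℕ → ℕ → GQC.P4)
    (hF : GQC.IsNormalized D F)
    (hFdvd : ∀ j ∈ Finset.Icc 1 l, F j j ∣ Polynomial.X ^ m j - 1)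
    (hE : GQC.IsNormalized (GQC.dualCode D) E)
    (i : ℕ) (hi1 : 1 ≤ i) (hil : i ≤ l)
    (G : ℕ → ℕ → GQC.P4)
    (hG : GQC.IsNormalized (Submodule.map (GQC.trunc hil) D) G)
    (hGdiag : ∀ r ∈ Finset.Icc 1 i, (G r r).Monic ∧ GQC.NoMultRoots (G r r))
    (H : ℕ → ℕ → ℕ → GQC.P4) (A B : ℕ → ℕ → GQC.P4)
    (hH : ∀ r ∈ Finset.Icc 1 (i - 1), GQC.IsElimination m G H A B r) :
    ∃ lam : ℕ → GQC.P4,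
      (∀ r ∈ Finset.Icc 1 (i - 1),
        E i r * (H (r - 1) r r).reverse = (Polynomial.X ^ m r - 1) * lam r) ∧
      (∀ s ∈ Finset.Icc 2 (i - 1),
        ∃ ux : (GQC.Mod (A s 1).reverse)ˣ,
          (ux : GQC.Mod (A s 1).reverse) = GQC.cls (A s 1).reverse Polynomial.X ∧
          GQC.cls (A s 1).reverse (lam s)
            = 3 * GQC.cls (A s 1).reverse (lam 1) *
                GQC.cls (A s 1).reverse (B s 1).reverse *
              ((ux ^ ((((Finset.Icc 1 i).lcm m : ℕ) : ℤ) + ((H (s - 2) s s).natDegree : ℤ)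
                - ((H (s - 2) s 1).natDegree : ℤ)) : (GQC.Mod (A s 1).reverse)ˣ))) ∧
      (GQC.IsElimination m G H A B i →
        E i i * (H (i - 1) i i).reverse = (Polynomial.X ^ m i - 1) * lam i ∧
        (2 ≤ i →
          ∃ ux ub : (GQC.Mod (A i 1).reverse)ˣ,
            (ux : GQC.Mod (A i 1).reverse) = GQC.cls (A i 1).reverse Polynomial.X ∧
            (ub : GQC.Mod (A i 1).reverse) = GQC.cls (A i 1).reverse (B i 1).reverse ∧
            GQC.cls (A i 1).reverse (lam 1)
              = 3 * GQC.cls (A i 1).reverse (lam i) * ((ub⁻¹ : (GQC.Mod (A i 1).reverse)ˣ)) *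
                ((ux ^ ((((Finset.Icc 1 i).lcm m : ℕ) : ℤ) + ((H (i - 2) i 1).natDegree : ℤ)
                  - ((H (i - 2) i i).natDegree : ℤ)) : (GQC.Mod (A i 1).reverse)ˣ)))) := by
  classical
  have hm0 : ∀ j ∈ Finset.Icc 1 l, 0 < m j := fun j hj => (hm j hj).pos
  have hi : i ∈ Finset.Icc 1 i := Finset.mem_Icc.2 ⟨hi1, le_rfl⟩
  have hil' : i ∈ Finset.Icc 1 l := Finset.mem_Icc.2 ⟨hi1, hil⟩
  have hGm : ∀ r ∈ Finset.Icc 1 i, (G r r).Monic := fun r hr => (hGdiag r hr).1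
  have he : (fun j : Finset.Icc 1 l => GQC.toBlk (m j) (E i j)) ∈ GQC.dualCode D :=
    hE.row_mem hil'
  have he0 : ∀ j ∈ Finset.Icc 1 l, i < j → E i j = 0 := hE.lower i hil'
  have hdvd : ∀ r ∈ Finset.Icc 1 i, GQC.IsElimination m G H A B r →
      X ^ m r - 1 ∣ E i r * (H (r - 1) r r).reverse := fun r hr h =>
    GQC.dvd_of_single_block hm0 he he0 hr (h.last_mem hG hGm hr)
  choose! lam hlam using hdvd
  have hrel : ∀ s ∈ Finset.Icc 2 i, GQC.IsElimination m G H A B 1 →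
      GQC.IsElimination m G H A B s → (A s 1).reverse ∣ lam 1 * (B s 1).reverse *
        X ^ (H (s - 2) s s).natDegree + lam s * X ^ (H (s - 2) s 1).natDegree := by
    intro s hs h1 h
    obtain ⟨hs2, hsi⟩ := Finset.mem_Icc.1 hs
    have hs1 : s ∈ Finset.Icc 1 i := Finset.mem_Icc.2 (by omega)
    have h1i : 1 ∈ Finset.Icc 1 i := Finset.mem_Icc.2 (by omega)
    obtain ⟨hdiag, d, hd, hA, hB, -, hG1, hH1⟩ := h.exists_last_step hs2
    have hmon := (h.invariant hG hGm hs1 (s - 2) (by omega)).1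
    have hl1 := hlam 1 h1i h1
    rw [h1.start 1 (by simp), hG1] at hl1
    have hls := hlam s hs1 h
    rw [hdiag] at hls
    exact GQC.dvd_of_two_blocks hm0 he he0 hs hA hB hd hmon
      (h.penultimate_mem hG hGm hs1 hs2) hH1 hl1 hls
  have hsub : ∀ r ∈ Finset.Icc 1 (i - 1), r ∈ Finset.Icc 1 i := fun r hr =>
    Finset.Icc_subset_Icc_right (Nat.sub_le i 1) hr
  refine ⟨lam, fun r hr => hlam r (hsub r hr) (hH r hr), fun s hs => ?_, fun hHi =>
    ⟨hlam i hi hHi, fun hi2 => ?_⟩⟩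
  · obtain ⟨hs2, hsi⟩ := Finset.mem_Icc.1 hs
    have h1' : 1 ∈ Finset.Icc 1 (i - 1) := Finset.mem_Icc.2 (by omega)
    have hHs := hH s (Finset.mem_Icc.2 (by omega))
    obtain ⟨-, d, hd, hA, -, -, hG1, -⟩ := hHs.exists_last_step hs2
    obtain ⟨u, hu⟩ := GQC.exists_unit_cls_X hA
    refine ⟨u, hu, ?_⟩
    have h0 := Ideal.Quotient.eq_zero_iff_mem.2 (Ideal.mem_span_singleton.2
      (hrel s (Finset.mem_Icc.2 (by omega)) (hH 1 h1') hHs))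
    rw [map_add, map_mul, map_mul, map_mul, map_pow, map_pow] at h0
    change _ * GQC.cls _ X ^ _ + _ * GQC.cls _ X ^ _ = _ at h0
    rw [← hu] at h0
    have hl1 := hlam 1 (hsub 1 h1') (hH 1 h1')
    rw [(hH 1 h1').start 1 (by simp), hG1, GQC.reverse_mul_of_monic hA hd] at hl1
    -- `A^* ∣ (G 1 1)^* ∣ (x^{m₁} - 1) λ₁`, so `x^{m'} λ₁ ≡ λ₁`
    have hper := GQC.cls_mul_pow_eq (Finset.dvd_lcm (hsub 1 h1'))
      (q := (A s 1).reverse) ⟨_, by rw [← hl1]; exact mul_left_comm _ _ _⟩ u hu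
    have h2 := GQC.eq_neg_mul_zpow u h0 (N := (Finset.Icc 1 i).lcm m)
      (by rw [mul_right_comm]; exact congrArg (· * _) hper)
    rw [GQC.three_eq_neg_one]
    exact h2.trans (by ring)
  · have h1' : 1 ∈ Finset.Icc 1 (i - 1) := Finset.mem_Icc.2 (by omega)
    obtain ⟨hdiag, d, hd, hA, -, hcop, hG1, -⟩ := hHi.exists_last_step hi2
    have hmon := (hHi.invariant hG hGm hi (i - 2) (by omega)).1
    obtain ⟨u, hu⟩ := GQC.exists_unit_cls_X hA
    obtain ⟨ub, hub⟩ := GQC.isUnit_cls_reverse hA hcop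
    refine ⟨u, ub, hu, hub, ?_⟩
    have h0 := Ideal.Quotient.eq_zero_iff_mem.2 (Ideal.mem_span_singleton.2
      (hrel i (Finset.mem_Icc.2 (by omega)) (hH 1 h1') hHi))
    rw [map_add, map_mul, map_mul, map_mul, map_pow, map_pow] at h0
    change _ * GQC.cls _ _ * GQC.cls _ X ^ _ + _ * GQC.cls _ X ^ _ = _ at h0
    rw [← hu, ← hub] at h0
    have hli := hlam i hi hHi
    rw [hdiag, GQC.reverse_mul_of_monic hA hmon] at hli
    -- `A^*` divides the reciprocal of the last diagonal entry, hence `(x^{m_i} - 1) λ_i`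
    have hper := GQC.cls_mul_pow_eq (Finset.dvd_lcm hi)
      (q := (A i 1).reverse) ⟨_, by rw [← hli]; exact mul_left_comm _ _ _⟩ u hu
    have hbb := ub.mul_inv
    have h2 := GQC.eq_neg_mul_zpow u (N := (Finset.Icc 1 i).lcm m)
      (x := GQC.cls (A i 1).reverse (lam i) * ((ub⁻¹ : (GQC.Mod (A i 1).reverse)ˣ)))
      (y := GQC.cls (A i 1).reverse (lam 1)) (a := (H (i - 2) i 1).natDegree)
      (c := (H (i - 2) i i).natDegree)
      (by
        set v := (((ub⁻¹ : (GQC.Mod (A i 1).reverse)ˣ)) : GQC.Mod (A i 1).reverse)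
        linear_combination v * h0
          - GQC.cls (A i 1).reverse (lam 1) *
            (u : GQC.Mod (A i 1).reverse) ^ (H (i - 2) i i).natDegree * hbb)
      (by rw [mul_right_comm]; exact congrArg (· * _) hper)
    rw [GQC.three_eq_neg_one]
    exact h2.trans (by ring)
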